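/- **Theorem 3.5 (Uniform bound of the determinant).** Let $\varepsilon>0$, let $\Omega=[-\pi,\pi]^d$ be the $2\pi$-periodic torus, and let $\|A\|_F=(\sum_{i,j}A_{ij}^2)^{1/2}$ be the Frobenius norm on $\mathbb R^{m\times m}$. Let $U^0:\Omega\to\mathbb R^{m\times m}$ be a (Lebesgue measurable, periodic) matrix field with $\|U^0(x)\|_F\le\sqrt m$ for every $x$. (i) Let $U:[0,\infty)\times\Omega\to\mathbb R^{m\times m}$ be a solution of the matrix-valued Allen–Cahn equation $$\partial_t U=\varepsilon^2\Delta U+U-UU^{\top}U,\qquad U(0,\cdot)=U^0,$$ that is, for $t>0$ the field $U$ is periodic in $x$, $U$ and $\partial_tU$ are continuous in $(t,x)$, $U(t,\cdot)$ is $C^2$, the equation holds pointwise, and $U(t,\cdot)\to U^0$ in $L^1(\Omega)$ as $t\downarrow0$. Then $|\det U(t,x)|\le 1$ for all $t\ge0$ and all $x\in\Omega$. (ii) For $\tau>0$ let $(U^n)_{n\ge0}$ be the Strang splitting iterates $$U^{n+1}=\mathcal S_{\mathcal L}(\tau/2)\,\mathcal S_{\mathcal N}(\tau)\,\mathcal S_{\mathcal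 L}(\tau/2)\,U^n$$ started from $U^0$, where $\mathcal S_{\mathcal L}(t)=e^{t\varepsilon^2\Delta}$ is the periodic heat semigroup applied entrywise and $$\mathcal S_{\mathcal N}(t)A=\bigl((e^{2t}-1)AA^{\top}+I\bigr)^{-1/2}e^{t}A$$ is applied pointwise. Then $|\det U^n(x)|\le 1$ for all $n\ge0$ and all $x\in\Omega$. -/

import Mathlib

open MeasureTheory Filter Topology
open scoped InnerProductSpace

noncomputable section

/-- The Euclidean space `ℝ^d`; functions on the torus `[-π, π]^d` are `2π`-periodic functions
on it. -/
abbrev Space (d : ℕ) : Type := EuclideanSpace ℝ (Fin d)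

/-- Real `m × m` matrices. -/
abbrev Mat (m : ℕ) : Type := Matrix (Fin m) (Fin m) ℝ

/-- The periodic cell `Ω = [-π, π]^d`. -/
def cell (d : ℕ) : Set (Space d) := {x | ∀ i, x i ∈ Set.Icc (-Real.pi) Real.pi}

/-- `u` is `2π`-periodic in each coordinate, i.e. it is a function on the torus. -/
def IsTorusFun {d : ℕ} {α : Type*} (u : Space d → α) : Prop :=
  ∀ i : Fin d, Function.Periodic u (EuclideanSpace.single i (2 * Real.pi))

section
open scoped Matrix.Norms.Frobenius

/-- The Frobenius norm of a matrix. -/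
def frobNorm {m : ℕ} (A : Mat m) : ℝ := ‖A‖

end

/-- `frobNorm` is the square root of the sum of the squares of the entries. -/
theorem frobNorm_eq {m : ℕ} (A : Mat m) : frobNorm A = √(∑ i, ∑ j, A i j ^ 2) := by
  unfold frobNorm
  rw [Matrix.frobenius_norm_def, Real.sqrt_eq_rpow]
  simp

/-- The heat semigroup `e^{sΔ}` (for `s > 0`) on scalar functions: convolution with the Gaussian
heat kernel of `ℝ^d`. On periodic functions this is the heat semigroup of the torus. -/
def heat {d : ℕ} (s : ℝ) (u : Space d → ℝ) (x : Space d) : ℝ :=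
  ∫ y, (4 * Real.pi * s) ^ (-(d : ℝ) / 2) * Real.exp (-‖x - y‖ ^ 2 / (4 * s)) * u y

/-- The linear propagator `S_L(t) = e^{t ε² Δ}`, applied entrywise. -/
def linProp {d m : ℕ} (ε t : ℝ) (U : Space d → Mat m) (x : Space d) : Mat m :=
  Matrix.of fun i j => heat (t * ε ^ 2) (fun y => U y i j) x

/-- The inverse square root `A^{-1/2}` of a symmetric positive definite matrix, by the
functional calculus. -/
def invSqrt {m : ℕ} (A : Mat m) : Mat m := cfc (fun s : ℝ => s ^ (-(1 / 2) : ℝ)) A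

/-- The nonlinear propagator `S_N(t) A = ((e^{2t} - 1) A Aᵀ + I)^{-1/2} e^t A`, the flow of
`A' = A - A Aᵀ A`. -/
def nonlinProp {m : ℕ} (t : ℝ) (A : Mat m) : Mat m :=
  invSqrt ((Real.exp (2 * t) - 1) • (A * A.transpose) + 1) * (Real.exp t • A)

/-- One step of the Strang splitting, `S_L(τ/2) S_N(τ) S_L(τ/2)`. -/
def strangStep {d m : ℕ} (ε τ : ℝ) (U : Space d → Mat m) : Space d → Mat m :=
  linProp ε (τ / 2) fun x => nonlinProp τ (linProp ε (τ / 2) U x)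

/-- The Strang splitting iterates `U^n` with initial datum `U⁰` and time step `τ`. -/
def strang {d m : ℕ} (ε τ : ℝ) (U₀ : Space d → Mat m) : ℕ → Space d → Mat m
  | 0 => U₀
  | n + 1 => strangStep ε τ (strang ε τ U₀ n)

/-- `U : [0, ∞) × Ω → ℝ^{m × m}` solves the matrix-valued Allen-Cahn equation
`∂ₜ U = ε² Δ U + U - U Uᵀ U` with initial datum `U⁰`: it is classical at positive times, and
it attains the (possibly discontinuous) initial datum in `L¹(Ω)` as `t ↓ 0`. -/
structure IsMACSolution {d m : ℕ} (ε : ℝ) (U₀ : Space d → Mat m) (U : ℝ → Space d → Mat m) :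
    Prop where
  /-- initial value -/
  initial : U 0 = U₀
  /-- periodicity in space -/
  periodic : ∀ t > 0, IsTorusFun (U t)
  /-- joint continuity at positive times -/
  continuousOn : ContinuousOn (fun p : ℝ × Space d => U p.1 p.2) (Set.Ioi 0 ×ˢ Set.univ)
  /-- twice continuously differentiable in space -/
  contDiff_space : ∀ t > 0, ∀ i j, ContDiff ℝ 2 fun x => U t x i j
  /-- the time derivative is jointly continuous -/
  continuousOn_deriv : ∀ i j, ContinuousOn
    (fun p : ℝ × Space d => deriv (fun s => U s p.2 i j) p.1) (Set.Ioi 0 ×ˢ Set.univ)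
  /-- the equation, entry by entry -/
  equation : ∀ t > 0, ∀ x i j, HasDerivAt (fun s => U s x i j)
    (ε ^ 2 * Laplacian.laplacian (fun y => U t y i j) x
      + (U t x - U t x * (U t x).transpose * U t x) i j) t
  /-- attainment of the initial datum -/
  tendsto_initial : ∀ i j, Tendsto
    (fun t => eLpNorm (fun x => U t x i j - U₀ x i j) 1 (volume.restrict (cell d)))
    (𝓝[>] 0) (𝓝 0)

end

noncomputable section

open scoped Pointwise

/-! By the arithmetic-geometric mean inequality for the eigenvalues of `A Aᵀ`, every matrix in the
closed Frobenius ball of radius `√m` has `|det| ≤ 1`. It therefore suffices that both evolutions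
leave this ball invariant.

For the splitting, each factor does. The heat propagator averages against a probability density and
the ball is convex (`trace_linProp_le`). The nonlinear flow sends an eigenvalue `s` of `A Aᵀ` to `q
s / ((q - 1) s + 1)` with `q = e^{2t}`. This function is concave, increasing and fixes `1`, so its
tangent at `1` keeps the mean of the eigenvalues at most `1` (`trace_nonlinProp_le`).

For the equation, the reaction term points inward outside the ball (`inner_reaction_nonpos`). Take a
`C¹` convex penalty `Φ` vanishing exactly on the ball. Diffusion contributes `∫ ⟪∇Φ(U), ΔU⟫ ≤ 0`, so
`∫ Φ(U)` is nonincreasing. Since `Φ` has linear growth, `L¹` attainment of the datum forces this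
integral to `0` as `t ↓ 0`, hence it vanishes for all `t > 0` (`norm_le_of_reaction_diffusion`). -/

/-! ### The Frobenius ball and the determinant -/

theorem trace_mul_transpose_self {m : ℕ} (A : Mat m) :
    (A * A.transpose).trace = ∑ i, ∑ j, A i j ^ 2 := by
  simp [Matrix.trace, Matrix.mul_apply, sq]

theorem frobNorm_le_sqrt_iff {m : ℕ} (A : Mat m) {c : ℝ} (hc : 0 ≤ c) :
    frobNorm A ≤ √c ↔ (A * A.transpose).trace ≤ c := by
  rw [frobNorm_eq, Real.sqrt_le_sqrt_iff hc, trace_mul_transpose_self]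

theorem posSemidef_mul_transpose_self {m : ℕ} (A : Mat m) : (A * A.transpose).PosSemidef := by
  simpa using Matrix.posSemidef_self_mul_conjTranspose A

/-- The determinant is at most one on the Frobenius ball of radius `√m`. -/
theorem abs_det_le_one_of_trace_le {m : ℕ} {A : Mat m} (h : (A * A.transpose).trace ≤ m) :
    |A.det| ≤ 1 := by
  have hps := posSemidef_mul_transpose_self A
  have hdet : A.det ^ 2 = ∏ i, hps.1.eigenvalues i := by
    have := hps.1.det_eq_prod_eigenvalues
    simpa [Matrix.det_mul, sq] using this
  have htr : ∑ i, (hps.1.eigenvalues i - 1) ≤ 0 := by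
    have := hps.1.trace_eq_sum_eigenvalues
    simp only [RCLike.ofReal_real_eq_id, id] at this
    simp [Finset.sum_sub_distrib, ← this, h]
  -- Arithmetic-geometric mean in exponential form: multiply the inequalities `λ ≤ e^{λ - 1}`.
  have hle : A.det ^ 2 ≤ 1 := by
    calc A.det ^ 2 = ∏ i, hps.1.eigenvalues i := hdet
      _ ≤ ∏ i, Real.exp (hps.1.eigenvalues i - 1) :=
        Finset.prod_le_prod (fun i _ => hps.eigenvalues_nonneg i)
          fun i _ => by linarith [Real.add_one_le_exp (hps.1.eigenvalues i - 1)]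
      _ = Real.exp (∑ i, (hps.1.eigenvalues i - 1)) := (Real.exp_sum _ _).symm
      _ ≤ 1 := Real.exp_le_one_iff.2 htr
  exact (sq_le_one_iff_abs_le_one _).1 hle

/-! ### The nonlinear propagator -/

theorem invSqrt_isSymm {m : ℕ} (C : Mat m) : (invSqrt C).transpose = invSqrt C := by
  have : IsSelfAdjoint (invSqrt C) := cfc_predicate _ _
  simpa [Matrix.star_eq_conjTranspose] using this.star_eq

theorem one_le_of_mem_spectrum {m : ℕ} {S : Mat m} (hS : S.PosSemidef) {c : ℝ} (hc : 0 ≤ c)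
    {s : ℝ} (hs : s ∈ spectrum ℝ (c • S + 1)) : 1 ≤ s := by
  have h1 : s - 1 ∈ spectrum ℝ (c • S) := by
    rw [show c • S = algebraMap ℝ (Mat m) (-1) + (c • S + 1) by simp,
      show s - 1 = s + -1 by ring,
      spectrum.add_mem_add_iff]
    exact hs
  have h2 := (Matrix.posSemidef_iff_isHermitian_and_spectrum_nonneg.1 (hS.smul hc)).2 h1
  simp at h2
  linarith

/-- All factors are functions of `C`, so this is a scalar identity on the spectrum. The spectrum is
finite, which makes every function continuous on it. -/
theorem invSqrt_mul_self_mul_invSqrt {m : ℕ} {C : Mat m} (hC : C.IsHermitian)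
    (hpos : ∀ s ∈ spectrum ℝ C, 0 < s) : invSqrt C * C * invSqrt C = 1 := by
  have hsa : IsSelfAdjoint C := hC
  have hfin : (spectrum ℝ C).Finite := Matrix.finite_real_spectrum
  have hcont : ∀ f : ℝ → ℝ, ContinuousOn f (spectrum ℝ C) := fun f => hfin.continuousOn f
  have hid : C = cfc (fun s : ℝ => s) C := (cfc_id' ℝ C).symm
  unfold invSqrt
  conv_lhs => enter [1, 2]; rw [hid]
  rw [← cfc_mul _ _ C (hcont _) (hcont _), ← cfc_mul _ _ C (hcont _) (hcont _), ← cfc_one ℝ C]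
  refine cfc_congr fun s hs => ?_
  have := hpos s hs
  have h : s ^ (-(1 / 2) : ℝ) * s ^ (-(1 / 2) : ℝ) = s⁻¹ := by
    rw [← Real.rpow_add this]; norm_num [Real.rpow_neg_one]
  simp only [Pi.one_apply]
  rw [mul_right_comm, h, inv_mul_cancel₀ this.ne']

/-- The nonlinear propagator preserves the Frobenius ball of radius `√m`. -/
theorem trace_nonlinProp_le {m : ℕ} {t : ℝ} (ht : 0 < t) {A : Mat m}
    (h : (A * A.transpose).trace ≤ m) :
    (nonlinProp t A * (nonlinProp t A).transpose).trace ≤ m := by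
  set q : ℝ := Real.exp (2 * t) with hq
  have hq1 : 1 < q := Real.one_lt_exp_iff.2 (by linarith)
  have hqt : Real.exp t * Real.exp t = q := by rw [← Real.exp_add, hq]; ring_nf
  set S := A * A.transpose with hS
  set C := (q - 1) • S + 1 with hC
  set B := invSqrt C with hB
  have hSps : S.PosSemidef := posSemidef_mul_transpose_self A
  have hCh : C.IsHermitian := ((hSps.smul (by linarith : 0 ≤ q - 1)).add Matrix.PosSemidef.one).1
  have hBs : B.transpose = B := invSqrt_isSymm C
  have hCs : C.transpose = C := by simpa using hCh.eq
  have hBCB : B * C * B = 1 := invSqrt_mul_self_mul_invSqrt hCh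
    fun s hs => lt_of_lt_of_le one_pos (one_le_of_mem_spectrum hSps (by linarith) hs)
  have hBBC : B * (B * C) = 1 := mul_eq_one_comm.1 hBCB
  have hN : nonlinProp t A * (nonlinProp t A).transpose = q • (B * S * B) := by
    change (B * (Real.exp t • A)) * (B * (Real.exp t • A)).transpose = _
    rw [Matrix.transpose_mul, hBs, Matrix.transpose_smul, hS]
    simp only [Matrix.mul_smul, Matrix.smul_mul, smul_smul, hqt, Matrix.mul_assoc]
  have hSC : (q - 1) • S = C - 1 := by rw [hC]; abel
  have h1 : (q - 1) * (B * S * B).trace = m - (B * B).trace := by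
    have : (q - 1) • (B * S * B) = 1 - B * B := by
      rw [← hBCB, ← Matrix.smul_mul, ← Matrix.mul_smul, hSC]
      noncomm_ring
    have := congrArg Matrix.trace this
    simpa [Matrix.trace_sub] using this
  have h2 : C.trace = (q - 1) * S.trace + m := by simp [hC]
  -- On an eigenvalue `c` of `C` this reads `(q - c)² / c ≥ 0`, the tangent line bound for `1 / c`
  -- at `c = q`. That point corresponds to the eigenvalue `1` of `S`, the fixed point of the flow.
  have h3 : 0 ≤ ((q • B - B * C) * (q • B - B * C).transpose).trace :=
    (posSemidef_mul_transpose_self _).trace_nonneg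
  have h4 : (q • B - B * C) * (q • B - B * C).transpose
      = (q * q) • (B * B) - (2 * q) • 1 + B * C * C * B := by
    rw [Matrix.transpose_sub, Matrix.transpose_smul, Matrix.transpose_mul, hBs, hCs, ← hBCB,
      sub_mul, mul_sub, mul_sub]
    simp only [Matrix.mul_smul, Matrix.smul_mul, smul_smul, Matrix.mul_assoc]
    module
  have h5 : (B * C * C * B).trace = C.trace := by
    rw [Matrix.trace_mul_comm, Matrix.mul_assoc B C C, ← Matrix.mul_assoc B,
      ← Matrix.mul_assoc (B * B), Matrix.mul_assoc B B C, hBBC, one_mul]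
  rw [h4] at h3
  simp only [Matrix.trace_add, Matrix.trace_sub, Matrix.trace_smul, h5, Matrix.trace_one,
    Fintype.card_fin, smul_eq_mul, h2] at h3
  rw [hN, Matrix.trace_smul, smul_eq_mul]
  -- Since `tr C ≤ q m`, the previous bound gives `q² tr(B²) ≥ 2 q m - tr C ≥ q m`.
  have h6 : q * q * ((q - 1) * (B * S * B).trace) ≤ q * ((q - 1) * m) := by
    rw [h1]
    nlinarith
  have h7 : 0 < q * (q - 1) := by nlinarith
  have h8 : q * (q - 1) * (q * (B * S * B).trace) ≤ q * (q - 1) * m := by linarith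
  exact le_of_mul_le_mul_left h8 h7

/-! ### Measurability of the nonlinear propagator -/

/-- A continuous function is a limit of polynomials, uniformly on bounded sets. -/
theorem exists_polynomial_tendsto (f : ℝ → ℝ) (hf : Continuous f) :
    ∃ p : ℕ → Polynomial ℝ, ∀ n : ℕ, ∀ s ∈ Set.Icc (-(n : ℝ)) n,
      |(p n).eval s - f s| < 1 / ((n : ℝ) + 1) :=
  ⟨fun n : ℕ => (exists_polynomial_near_of_continuousOn (-((n : ℕ) : ℝ)) (n : ℕ) f hf.continuousOn
    (1 / ((n : ℝ) + 1)) (by positivity)).choose,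
   fun n : ℕ => (exists_polynomial_near_of_continuousOn (-((n : ℕ) : ℝ)) (n : ℕ) f hf.continuousOn
    (1 / ((n : ℝ) + 1)) (by positivity)).choose_spec⟩

instance measurableSpaceMat (m : ℕ) : MeasurableSpace (Mat m) :=
  inferInstanceAs (MeasurableSpace (Fin m → Fin m → ℝ))

instance borelSpaceMat (m : ℕ) : BorelSpace (Mat m) :=
  inferInstanceAs (BorelSpace (Fin m → Fin m → ℝ))

instance pseudoMetrizableSpaceMat (m : ℕ) : TopologicalSpace.PseudoMetrizableSpace (Mat m) :=
  inferInstanceAs (TopologicalSpace.PseudoMetrizableSpace (Fin m → Fin m → ℝ))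

instance secondCountableTopologyMat (m : ℕ) : SecondCountableTopology (Mat m) :=
  inferInstanceAs (SecondCountableTopology (Fin m → Fin m → ℝ))

/-- Polynomials in `C x` are measurable in `x`. The Weierstrass approximants on `[-n, n]` converge
uniformly on each spectrum, because a finite spectrum lies in `[-n, n]` for large `n`. -/
theorem measurable_cfc_comp {X : Type*} [MeasurableSpace X] {m : ℕ} {f : ℝ → ℝ}
    (hf : Continuous f) {C : X → Mat m} (hC : Measurable C) (hCh : ∀ x, (C x).IsHermitian) :
    Measurable fun x => cfc f (C x) := by
  obtain ⟨p, hp⟩ := exists_polynomial_tendsto f hf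
  refine measurable_of_tendsto_metrizable (f := fun n x => Polynomial.aeval (C x) (p n))
    (fun n => ?_) (tendsto_pi_nhds.2 fun x => ?_)
  · exact (Polynomial.continuous_aeval (p n)).measurable.comp hC
  · have hsa : IsSelfAdjoint (C x) := hCh x
    have hfin : (spectrum ℝ (C x)).Finite := Matrix.finite_real_spectrum
    simp_rw [← cfc_polynomial _ (C x) hsa]
    refine tendsto_cfc_fun ?_ (Eventually.of_forall fun n => hfin.continuousOn _)
    rw [Metric.tendstoUniformlyOn_iff]
    intro δ hδ
    obtain ⟨R, hR⟩ := hfin.isBounded.subset_closedBall 0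
    obtain ⟨N, hN⟩ := exists_nat_one_div_lt hδ
    filter_upwards [eventually_ge_atTop N, eventually_ge_atTop ⌈R⌉₊] with n hn hn' s hs
    have hsR : |s| ≤ n := by
      have := hR hs
      simp only [Metric.mem_closedBall, dist_zero_right, Real.norm_eq_abs] at this
      exact this.trans ((Nat.le_ceil R).trans (by exact_mod_cast hn'))
    rw [dist_comm, Real.dist_eq]
    calc _ < 1 / ((n : ℝ) + 1) := hp n s (abs_le.1 hsR)
      _ ≤ 1 / ((N : ℝ) + 1) := by gcongr
      _ < δ := hN

theorem measurable_nonlinProp {m : ℕ} {t : ℝ} (ht : 0 < t) :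
    Measurable (nonlinProp t : Mat m → Mat m) := by
  have hq : 0 ≤ Real.exp (2 * t) - 1 := by
    linarith [Real.one_lt_exp_iff.2 (by linarith : 0 < 2 * t)]
  have hps : ∀ A : Mat m, ((Real.exp (2 * t) - 1) • (A * A.transpose) + 1).IsHermitian := fun A =>
    (((posSemidef_mul_transpose_self A).smul hq).add Matrix.PosSemidef.one).1
  have hCc : Continuous fun A : Mat m => (Real.exp (2 * t) - 1) • (A * A.transpose) + 1 := by
    fun_prop
  -- The function `s ^ (-1/2)` is not continuous at `0`. The truncation `max s 1` changes nothing on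
  -- the spectrum, which lies in `[1, ∞)`.
  have hf : Continuous fun s : ℝ => (max s 1) ^ (-(1 / 2) : ℝ) :=
    (continuous_id.max continuous_const).rpow_const fun s => Or.inl (by positivity)
  have h1 := measurable_cfc_comp hf hCc.measurable hps
  have h2 : (nonlinProp t : Mat m → Mat m) = fun A =>
      cfc (fun s : ℝ => (max s 1) ^ (-(1 / 2) : ℝ))
        ((Real.exp (2 * t) - 1) • (A * A.transpose) + 1) * (Real.exp t • A) := by
    funext A
    refine congrArg (· * (Real.exp t • A)) (cfc_congr fun s hs => ?_)
    simp only [max_eq_left (one_le_of_mem_spectrum (posSemidef_mul_transpose_self A) hq hs)]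
  rw [h2]
  have hmul : Continuous fun P : Mat m × Mat m => P.1 * P.2 := by fun_prop
  exact hmul.measurable.comp (h1.prodMk (by fun_prop : Continuous fun A : Mat m =>
    Real.exp t • A).measurable)

/-! ### The heat propagator and the Strang iterates -/

/-- The Gaussian heat kernel of `ℝ^d`. -/
def heatKernel {d : ℕ} (s : ℝ) (x y : Space d) : ℝ :=
  (4 * Real.pi * s) ^ (-(d : ℝ) / 2) * Real.exp (-‖x - y‖ ^ 2 / (4 * s))

theorem heatKernel_nonneg {d : ℕ} {s : ℝ} (hs : 0 < s) (x y : Space d) :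
    0 ≤ heatKernel s x y := by
  unfold heatKernel; positivity

theorem continuous_heatKernel {d : ℕ} (s : ℝ) :
    Continuous fun p : Space d × Space d => heatKernel s p.1 p.2 := by
  unfold heatKernel; fun_prop

theorem integral_heatKernel {d : ℕ} {s : ℝ} (hs : 0 < s) (x : Space d) :
    ∫ y, heatKernel s x y = 1 := by
  have hb : 0 < 1 / (4 * s) := by positivity
  have h := GaussianFourier.integral_rexp_neg_mul_sq_norm (V := Space d) hb
  unfold heatKernel
  rw [integral_const_mul,
    integral_sub_left_eq_self (fun z : Space d => Real.exp (-‖z‖ ^ 2 / (4 * s))) volume x]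
  have h2 : ∀ z : Space d, Real.exp (-‖z‖ ^ 2 / (4 * s)) = Real.exp (-(1 / (4 * s)) * ‖z‖ ^ 2) :=
    fun z => by congr 1; ring
  simp_rw [h2]
  rw [h, finrank_euclideanSpace_fin, show Real.pi / (1 / (4 * s)) = 4 * Real.pi * s by
    field_simp, ← Real.rpow_add (by positivity)]
  ring_nf
  simp

/-- The integral of a non-integrable function is `0` by convention, so total mass `1` already gives
integrability. -/
theorem integrable_heatKernel {d : ℕ} {s : ℝ} (hs : 0 < s) (x : Space d) :
    Integrable (heatKernel s x) :=
  .of_integral_ne_zero (by rw [integral_heatKernel hs]; exact one_ne_zero)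

theorem aemeasurable_heat {d : ℕ} (s : ℝ) {u : Space d → ℝ} (hu : AEMeasurable u) :
    AEMeasurable (heat s u) := by
  have h : AEStronglyMeasurable (fun p : Space d × Space d => heatKernel s p.1 p.2 * u p.2)
      (volume.prod volume) :=
    (continuous_heatKernel s).aestronglyMeasurable.mul hu.aestronglyMeasurable.comp_snd
  exact h.integral_prod_right'.aemeasurable

theorem entry_sq_le_trace {m : ℕ} (A : Mat m) (i j : Fin m) :
    A i j ^ 2 ≤ (A * A.transpose).trace := by
  rw [trace_mul_transpose_self]
  exact (Finset.single_le_sum (f := fun j => A i j ^ 2) (fun _ _ => sq_nonneg _)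
    (Finset.mem_univ j)).trans (Finset.single_le_sum (f := fun i => ∑ j, A i j ^ 2)
      (fun _ _ => Finset.sum_nonneg fun _ _ => sq_nonneg _) (Finset.mem_univ i))

/-- Averaging against the heat kernel preserves Frobenius balls. -/
theorem trace_linProp_le {d m : ℕ} {ε t c : ℝ} (hε : 0 < ε) (ht : 0 < t) {U : Space d → Mat m}
    (hU : ∀ i j, AEMeasurable (fun x => U x i j)) (h : ∀ x, (U x * (U x).transpose).trace ≤ c)
    (x : Space d) :
    (linProp ε t U x * (linProp ε t U x).transpose).trace ≤ c := by
  have hs : 0 < t * ε ^ 2 := by positivity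
  set V := linProp ε t U x with hV
  set k := heatKernel (t * ε ^ 2) x with hk
  set T := (V * V.transpose).trace with hT
  have hint : ∀ i j, Integrable fun y => k y * U y i j := fun i j => by
    refine (integrable_heatKernel hs x).mul_bdd (c := √c) (hU i j).aestronglyMeasurable
      (Eventually.of_forall fun y => ?_)
    exact Real.abs_le_sqrt ((entry_sq_le_trace _ i j).trans (h y))
  have hent : ∀ i j, V i j = ∫ y, k y * U y i j := fun i j => rfl
  have h1 : T = ∫ y, k y * ∑ i, ∑ j, V i j * U y i j := by
    calc T = ∑ i, ∑ j, V i j * ∫ y, k y * U y i j := by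
          rw [hT, trace_mul_transpose_self]
          refine Finset.sum_congr rfl fun i _ => Finset.sum_congr rfl fun j _ => ?_
          rw [← hent, sq]
      _ = ∑ i, ∑ j, ∫ y, V i j * (k y * U y i j) := by simp_rw [integral_const_mul]
      _ = ∫ y, ∑ i, ∑ j, V i j * (k y * U y i j) := by
          refine Eq.symm ((integral_finsetSum _ fun i _ => integrable_finsetSum _ fun j _ =>
            (hint i j).const_mul _).trans ?_)
          exact Finset.sum_congr rfl fun i _ =>
            integral_finsetSum _ fun j _ => (hint i j).const_mul _
      _ = _ := by
          refine integral_congr_ae (Eventually.of_forall fun y => ?_)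
          simp only [Finset.mul_sum]
          exact Finset.sum_congr rfl fun i _ => Finset.sum_congr rfl fun j _ => by ring
  -- Young's inequality `⟪V, U y⟫ ≤ (‖V‖² + ‖U y‖²) / 2` under the average gives `T ≤ (T + c) / 2`,
  -- hence `T ≤ c`.
  have h2 : T ≤ ∫ y, k y * ((T + c) / 2) := by
    rw [h1]
    refine integral_mono ?_ ((integrable_heatKernel hs x).mul_const _) fun y => ?_
    · have : (fun y => k y * ∑ i, ∑ j, V i j * U y i j)
          = fun y => ∑ i, ∑ j, V i j * (k y * U y i j) := by
        funext y
        simp only [Finset.mul_sum]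
        exact Finset.sum_congr rfl fun i _ => Finset.sum_congr rfl fun j _ => by ring
      rw [this]
      exact integrable_finsetSum _ fun i _ => integrable_finsetSum _ fun j _ =>
        (hint i j).const_mul _
    · refine mul_le_mul_of_nonneg_left ?_ (heatKernel_nonneg hs x y)
      have hy := h y
      rw [← h1]
      calc ∑ i, ∑ j, V i j * U y i j ≤ ∑ i, ∑ j, (V i j ^ 2 + U y i j ^ 2) / 2 := by
            gcongr with i _ j _
            nlinarith [sq_nonneg (V i j - U y i j)]
        _ = (T + (U y * (U y).transpose).trace) / 2 := by
            rw [hT, trace_mul_transpose_self, trace_mul_transpose_self]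
            simp_rw [← Finset.sum_div, Finset.sum_add_distrib]
        _ ≤ (T + c) / 2 := by gcongr
  rw [integral_mul_const, hk, integral_heatKernel hs, one_mul] at h2
  linarith

theorem aemeasurable_linProp {d m : ℕ} (ε t : ℝ) {U : Space d → Mat m}
    (hU : ∀ i j, AEMeasurable (fun x => U x i j)) (i j : Fin m) :
    AEMeasurable fun x => linProp ε t U x i j :=
  aemeasurable_heat _ (hU i j)

theorem aemeasurable_nonlinProp {d m : ℕ} {t : ℝ} (ht : 0 < t) {U : Space d → Mat m}
    (hU : ∀ i j, AEMeasurable (fun x => U x i j)) (i j : Fin m) :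
    AEMeasurable fun x => nonlinProp t (U x) i j := by
  have h1 : AEMeasurable U := aemeasurable_pi_lambda U fun i => aemeasurable_pi_lambda _ (hU i)
  have hent : Continuous fun A : Mat m => A i j := by fun_prop
  exact (hent.measurable.comp (measurable_nonlinProp ht)).comp_aemeasurable h1

/-- The Strang iterates stay measurable and in the Frobenius ball of radius `√m`. -/
theorem strang_invariant {d m : ℕ} {ε τ : ℝ} (hε : 0 < ε) (hτ : 0 < τ) {U₀ : Space d → Mat m}
    (hU : ∀ i j, AEMeasurable (fun x => U₀ x i j))
    (h : ∀ x, (U₀ x * (U₀ x).transpose).trace ≤ m) (n : ℕ) :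
    (∀ i j, AEMeasurable fun x => strang ε τ U₀ n x i j) ∧
      ∀ x, (strang ε τ U₀ n x * (strang ε τ U₀ n x).transpose).trace ≤ m := by
  induction n with
  | zero => exact ⟨hU, h⟩
  | succ n ih =>
    have hm := aemeasurable_nonlinProp hτ (aemeasurable_linProp ε (τ / 2) ih.1)
    exact ⟨aemeasurable_linProp ε (τ / 2) hm, trace_linProp_le hε (half_pos hτ) hm fun x =>
      trace_nonlinProp_le hτ (trace_linProp_le hε (half_pos hτ) ih.1 ih.2 x)⟩

/-! ### The period lattice and the cell -/

/-- The basis of the period lattice. -/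
def periodBasis (d : ℕ) : Module.Basis (Fin d) ℝ (Space d) :=
  (EuclideanSpace.basisFun (Fin d) ℝ).toBasis.isUnitSMul
    (w := fun _ => 2 * Real.pi) fun _ => (by positivity : (2 * Real.pi) ≠ 0).isUnit

theorem periodBasis_apply {d : ℕ} (i : Fin d) :
    periodBasis d i = EuclideanSpace.single i (2 * Real.pi) := by
  ext j
  simp [periodBasis, Module.Basis.isUnitSMul_apply]

theorem periodBasis_repr {d : ℕ} (x : Space d) (i : Fin d) :
    (periodBasis d).repr x i = (2 * Real.pi)⁻¹ * x i := by
  simp [periodBasis, Module.Basis.repr_isUnitSMul, Units.smul_def]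

/-- The period lattice. -/
abbrev periodLattice (d : ℕ) : AddSubgroup (Space d) :=
  (Submodule.span ℤ (Set.range (periodBasis d))).toAddSubgroup

theorem IsTorusFun.add_period {d : ℕ} {α : Type*} {u : Space d → α} (hu : IsTorusFun u)
    (g : periodLattice d) (x : Space d) : u (x + g) = u x := by
  suffices h : ∀ y ∈ Submodule.span ℤ (Set.range (periodBasis d)), Function.Periodic u y from
    h g g.2 x
  intro y hy
  induction hy using Submodule.span_induction with
  | mem y hy =>
    obtain ⟨i, rfl⟩ := hy
    rw [periodBasis_apply]
    exact hu i
  | zero => exact fun x => by rw [add_zero]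
  | add a b _ _ iha ihb => exact iha.add_period ihb
  | smul k a _ iha => exact iha.zsmul k

/-- The lower corner of the cell. -/
def cellCorner (d : ℕ) : Space d := WithLp.toLp 2 fun _ => -Real.pi

theorem mem_vadd_fundamentalDomain {d : ℕ} (x : Space d) :
    x ∈ cellCorner d +ᵥ ZSpan.fundamentalDomain (periodBasis d) ↔
      ∀ i, x i ∈ Set.Ico (-Real.pi) Real.pi := by
  rw [Set.mem_vadd_set_iff_neg_vadd_mem]
  simp only [ZSpan.mem_fundamentalDomain, periodBasis_repr]
  refine forall_congr' fun i => ?_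
  have h2 : (0 : ℝ) < 2 * Real.pi := by positivity
  simp only [cellCorner, vadd_eq_add, PiLp.add_apply, PiLp.neg_apply, Set.mem_Ico]
  rw [inv_mul_lt_iff₀ h2, mul_nonneg_iff_of_pos_left (inv_pos.2 h2)]
  constructor <;> rintro ⟨h3, h4⟩ <;> constructor <;> linarith

theorem cell_ae_eq (d : ℕ) :
    cell d =ᵐ[volume] (cellCorner d +ᵥ ZSpan.fundamentalDomain (periodBasis d) : Set (Space d)) := by
  have h := (Measure.univ_pi_Ico_ae_eq_Icc (μ := fun _ : Fin d => (volume : Measure ℝ))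
    (f := fun _ => -Real.pi) (g := fun _ => Real.pi)).symm
  have hp := (PiLp.volume_preserving_ofLp (Fin d)).quasiMeasurePreserving.preimage_ae_eq h
  have h1 : cell d = WithLp.ofLp ⁻¹' Set.Icc (fun _ => -Real.pi) fun _ => Real.pi := by
    ext x
    simp [cell, Pi.le_def, forall_and]
  have h2 : (cellCorner d +ᵥ ZSpan.fundamentalDomain (periodBasis d) : Set (Space d))
      = WithLp.ofLp ⁻¹' Set.univ.pi fun _ => Set.Ico (-Real.pi) Real.pi := by
    ext x
    rw [mem_vadd_fundamentalDomain]
    simp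
  rw [h1, h2]
  exact hp

theorem isAddFundamentalDomain_vadd_cell {d : ℕ} (v : Space d) :
    IsAddFundamentalDomain (periodLattice d)
      (v +ᵥ ZSpan.fundamentalDomain (periodBasis d) : Set (Space d)) volume :=
  (ZSpan.isAddFundamentalDomain' (periodBasis d) volume).vadd_of_comm v

/-- The integral of a periodic function over the cell is invariant under translations. -/
theorem IsTorusFun.setIntegral_cell_add {d : ℕ} {u : Space d → ℝ} (hu : IsTorusFun u)
    (v : Space d) : ∫ x in cell d, u (x + v) = ∫ x in cell d, u x := by
  have hper : ∀ (g : periodLattice d) (x : Space d), u (g +ᵥ x) = u x := fun g x => by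
    rw [AddSubgroup.vadd_def, vadd_eq_add, add_comm, hu.add_period]
  have : Countable (periodLattice d) :=
    inferInstanceAs (Countable (Submodule.span ℤ (Set.range (periodBasis d))))
  set F := ZSpan.fundamentalDomain (periodBasis d)
  -- Translating the integrand amounts to translating the domain, and any two translates of a
  -- fundamental domain give a periodic function the same integral.
  have h1 := (measurePreserving_add_right (volume : Measure (Space d)) v).setIntegral_preimage_emb
    (measurableEmbedding_addRight v) u ((cellCorner d + v) +ᵥ F)
  rw [setIntegral_congr_set (cell_ae_eq d), setIntegral_congr_set (cell_ae_eq d),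
    (isAddFundamentalDomain_vadd_cell (cellCorner d)).setIntegral_eq
      (isAddFundamentalDomain_vadd_cell (cellCorner d + v)) hper, ← h1]
  congr 2
  ext x
  simp only [Set.mem_preimage, Set.mem_vadd_set_iff_neg_vadd_mem, vadd_eq_add, F]
  rw [show -(cellCorner d + v) + (x + v) = -cellCorner d + x by abel]

theorem exists_add_period_mem_cell {d : ℕ} (x : Space d) :
    ∃ g : periodLattice d, x + g ∈ cell d := by
  obtain ⟨g, hg, -⟩ := ZSpan.exist_unique_vadd_mem_fundamentalDomain (periodBasis d)
    (x - cellCorner d)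
  refine ⟨g, ?_⟩
  have h : x + (g : Space d) ∈ cellCorner d +ᵥ ZSpan.fundamentalDomain (periodBasis d) := by
    rw [Set.mem_vadd_set_iff_neg_vadd_mem]
    convert hg using 1
    rw [Submodule.vadd_def]
    simp only [vadd_eq_add]
    abel
  exact fun i => Set.Ico_subset_Icc_self ((mem_vadd_fundamentalDomain _).1 h i)

theorem isCompact_cell (d : ℕ) : IsCompact (cell d) := by
  have h : cell d = (EuclideanSpace.equiv (Fin d) ℝ).toHomeomorph ⁻¹'
      Set.pi Set.univ fun _ => Set.Icc (-Real.pi) Real.pi := by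
    ext x; simp [cell, Pi.le_def, forall_and]
  rw [h, Homeomorph.isCompact_preimage]
  exact isCompact_univ_pi fun _ => isCompact_Icc

/-- Needed to turn almost everywhere equality of continuous functions into equality on the whole
closed cell, boundary included. -/
theorem cell_subset_closure_interior (d : ℕ) : cell d ⊆ closure (interior (cell d)) := by
  have h : cell d = (EuclideanSpace.equiv (Fin d) ℝ).toHomeomorph ⁻¹'
      Set.pi Set.univ fun _ => Set.Icc (-Real.pi) Real.pi := by
    ext x; simp [cell, Pi.le_def, forall_and]
  rw [h, ← Homeomorph.preimage_interior, ← Homeomorph.preimage_closure,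
    interior_pi_set Set.finite_univ, closure_pi_set]
  simp only [interior_Icc, closure_Ioo (by linarith [Real.pi_pos] : -Real.pi ≠ Real.pi)]
  exact subset_rfl

/-! ### Calculus preliminaries -/

/-- Differentiation under the integral sign over a compact set. -/
theorem hasDerivAt_setIntegral_of_continuousOn {d : ℕ} {K : Set (Space d)} (hK : IsCompact K)
    {S : Set ℝ} (hS : IsOpen S) {f f' : ℝ → Space d → ℝ}
    (hf : ContinuousOn (fun q : ℝ × Space d => f q.1 q.2) (S ×ˢ Set.univ))
    (hf' : ContinuousOn (fun q : ℝ × Space d => f' q.1 q.2) (S ×ˢ Set.univ))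
    (hd : ∀ s ∈ S, ∀ x, HasDerivAt (fun s => f s x) (f' s x) s) {t : ℝ} (ht : t ∈ S) :
    HasDerivAt (fun s => ∫ x in K, f s x) (∫ x in K, f' t x) t := by
  have slice : ∀ g : ℝ → Space d → ℝ,
      ContinuousOn (fun q : ℝ × Space d => g q.1 q.2) (S ×ˢ Set.univ) →
      ∀ s ∈ S, Continuous (g s) := fun g hg s hs =>
    continuousOn_univ.1 (hg.comp (by fun_prop : Continuous fun x : Space d => (s, x)).continuousOn
      fun x _ => ⟨hs, trivial⟩)
  obtain ⟨r, hr, hrS⟩ := Metric.nhds_basis_closedBall.mem_iff.1 (hS.mem_nhds ht)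
  obtain ⟨C, hC⟩ := ((isCompact_closedBall t r).prod hK).exists_bound_of_continuousOn
    (hf'.mono (Set.prod_mono hrS (Set.subset_univ _)))
  refine (hasDerivAt_integral_of_dominated_loc_of_deriv_le (bound := fun _ => C)
    (Metric.closedBall_mem_nhds t hr) ?_ ?_ ?_ ?_ ?_ ?_).2
  · filter_upwards [hS.mem_nhds ht] with s hs
    exact (slice f hf s hs).aestronglyMeasurable
  · exact (slice f hf t ht).continuousOn.integrableOn_compact hK
  · exact (slice f' hf' t ht).aestronglyMeasurable
  · filter_upwards [ae_restrict_mem hK.measurableSet] with x hx s hs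
    exact hC (s, x) ⟨hs, hx⟩
  · exact continuousOn_const.integrableOn_compact hK
  · exact Eventually.of_forall fun x s hs => hd s (hrS hs) x

/-- The second order necessary condition at a maximum. -/
theorem second_deriv_nonpos_of_isMax {G G' : ℝ → ℝ} {c x : ℝ} (hG : ∀ h, HasDerivAt G (G' h) h)
    (hG' : HasDerivAt G' c x) (hmax : ∀ h, G h ≤ G x) : c ≤ 0 := by
  by_contra! hc
  have hd : deriv G = G' := funext fun h => (hG h).deriv
  have hlmax : IsLocalMax G x := Eventually.of_forall hmax
  -- If `c > 0`, the point `x` is a local minimum as well as a maximum, so `G` is constant near `x`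
  -- and `c = 0`.
  have hmin : IsLocalMin G x := isLocalMin_of_deriv_deriv_pos (by rw [hd, hG'.deriv]; exact hc)
    hlmax.deriv_eq_zero (hG x).continuousAt
  have hconst : G =ᶠ[𝓝 x] fun _ => G x := by
    filter_upwards [hmin] with h hh using le_antisymm (hmax h) hh
  have hzero : G' =ᶠ[𝓝 x] fun _ => 0 := by
    have := hconst.deriv
    rw [hd] at this
    simpa using this
  exact hc.ne' (hG'.unique ((hasDerivAt_const x (0 : ℝ)).congr_of_eventuallyEq hzero))

/-! ### The convex penalty and the sign of the diffusion term -/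

section
variable {E : Type*} [NormedAddCommGroup E]

/-- A `C¹` convex function of linear growth vanishing exactly on the ball of radius `a`. -/
def ballPenalty (a : ℝ) (A : E) : ℝ := √(1 + max (‖A‖ - a) 0 ^ 2) - 1

theorem ballPenalty_nonneg (a : ℝ) (A : E) : 0 ≤ ballPenalty a A := by
  unfold ballPenalty
  have : 1 ≤ √(1 + max (‖A‖ - a) 0 ^ 2) :=
    Real.one_le_sqrt.2 (by nlinarith [sq_nonneg (max (‖A‖ - a) 0)])
  linarith

/-- This linear growth lets `L¹` convergence to the initial datum control the integral of the
penalty. -/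
theorem ballPenalty_le (a : ℝ) (A : E) : ballPenalty a A ≤ max (‖A‖ - a) 0 := by
  unfold ballPenalty
  have h0 : 0 ≤ max (‖A‖ - a) 0 := le_max_right _ _
  have : √(1 + max (‖A‖ - a) 0 ^ 2) ≤ 1 + max (‖A‖ - a) 0 :=
    Real.sqrt_le_iff.2 ⟨by linarith, by nlinarith⟩
  linarith

theorem norm_le_of_ballPenalty_eq_zero {a : ℝ} {A : E} (h : ballPenalty a A = 0) : ‖A‖ ≤ a := by
  unfold ballPenalty at h
  have h1 : √(1 + max (‖A‖ - a) 0 ^ 2) = 1 := by linarith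
  rw [Real.sqrt_eq_one] at h1
  have h2 : max (‖A‖ - a) 0 = 0 := by nlinarith
  linarith [le_max_left (‖A‖ - a) 0]

end

section
variable {E : Type*} [NormedAddCommGroup E] [InnerProductSpace ℝ E]

/-- A function with a continuous field of subgradients is differentiable. -/
theorem hasFDerivAt_of_subgradient {Φ : E → ℝ} {p : E → E} (hp : Continuous p)
    (hsub : ∀ A B, Φ A + ⟪p A, B - A⟫_ℝ ≤ Φ B) (A : E) :
    HasFDerivAt Φ (innerSL ℝ (p A)) A := by
  rw [hasFDerivAt_iff_isLittleO, Asymptotics.isLittleO_iff]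
  intro c hc
  have hev : ∀ᶠ B in 𝓝 A, ‖p B - p A‖ < c := by
    have := (hp.tendsto A).eventually (Metric.ball_mem_nhds (p A) hc)
    filter_upwards [this] with B hB
    rwa [← dist_eq_norm]
  filter_upwards [hev] with B hB
  -- The two subgradient inequalities squeeze the remainder: `0 ≤ Φ B - Φ A - ⟪p A, B - A⟫ ≤ ⟪p B -
  -- p A, B - A⟫`.
  have h1 := hsub A B
  have h2 := hsub B A
  have h3 : ⟪p B, A - B⟫_ℝ = -⟪p B, B - A⟫_ℝ := by rw [← inner_neg_right, neg_sub]
  have h4 : ⟪p B - p A, B - A⟫_ℝ ≤ c * ‖B - A‖ :=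
    (real_inner_le_norm _ _).trans (by gcongr)
  rw [inner_sub_left] at h4
  rw [innerSL_apply_apply, Real.norm_eq_abs, abs_of_nonneg (by linarith)]
  linarith

/-- For convex `Φ` with subgradients `p` and periodic `w`, the second directional derivative of
`w` tested against `p ∘ w` has nonpositive integral. -/
theorem setIntegral_inner_fderiv_fderiv_nonpos {d : ℕ} {w : Space d → E} (hw : ContDiff ℝ 2 w)
    (hper : IsTorusFun w) {Φ : E → ℝ} {p : E → E} (hp : Continuous p)
    (hsub : ∀ A B, Φ A + ⟪p A, B - A⟫_ℝ ≤ Φ B) (v : Space d) :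
    ∫ x in cell d, ⟪p (w x), fderiv ℝ (fderiv ℝ w) x v v⟫_ℝ ≤ 0 := by
  have hΦ : Continuous Φ := continuous_iff_continuousAt.2 fun A =>
    (hasFDerivAt_of_subgradient hp hsub A).continuousAt
  have hw1 : ContDiff ℝ 1 (fderiv ℝ w) := hw.fderiv_right (by norm_num)
  have hwc := hw.continuous
  have hw1c := hw1.continuous
  have hw2c : Continuous (fderiv ℝ (fderiv ℝ w)) := hw1.continuous_fderiv (by norm_num)
  have hline : ∀ (x : Space d) (h : ℝ), HasDerivAt (fun h : ℝ => x + h • v) v h := fun x h => by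
    simpa using ((hasDerivAt_id h).smul_const v).const_add x
  have hd1 : ∀ (h : ℝ) (x : Space d), HasDerivAt (fun h : ℝ => ⟪p (w x), w (x + h • v)⟫_ℝ)
      ⟪p (w x), fderiv ℝ w (x + h • v) v⟫_ℝ h := fun h x => by
    have := ((hw.differentiable (by norm_num) (x + h • v)).hasFDerivAt.comp_hasDerivAt h
      (hline x h))
    exact (innerSL ℝ (p (w x))).hasFDerivAt.comp_hasDerivAt h this
  have hd2 : ∀ (h : ℝ) (x : Space d), HasDerivAt
      (fun h : ℝ => ⟪p (w x), fderiv ℝ w (x + h • v) v⟫_ℝ)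
      ⟪p (w x), fderiv ℝ (fderiv ℝ w) (x + h • v) v v⟫_ℝ h := fun h x => by
    have hA : HasDerivAt (fun h : ℝ => fderiv ℝ w (x + h • v))
        (fderiv ℝ (fderiv ℝ w) (x + h • v) v) h :=
      (hw1.differentiable (by norm_num) (x + h • v)).hasFDerivAt.comp_hasDerivAt h (hline x h)
    have hB : HasDerivAt (fun h : ℝ => fderiv ℝ w (x + h • v) v)
        (fderiv ℝ (fderiv ℝ w) (x + h • v) v v) h := by
      simpa using hA.clm_apply (hasDerivAt_const h v)
    exact (innerSL ℝ (p (w x))).hasFDerivAt.comp_hasDerivAt h hB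
  have hc0 : Continuous fun q : ℝ × Space d => ⟪p (w q.2), w (q.2 + q.1 • v)⟫_ℝ := by fun_prop
  have hc1 : Continuous fun q : ℝ × Space d => ⟪p (w q.2), fderiv ℝ w (q.2 + q.1 • v) v⟫_ℝ := by
    fun_prop
  have hc2 : Continuous fun q : ℝ × Space d =>
      ⟪p (w q.2), fderiv ℝ (fderiv ℝ w) (q.2 + q.1 • v) v v⟫_ℝ := by fun_prop
  have hG := fun h : ℝ => hasDerivAt_setIntegral_of_continuousOn (isCompact_cell d) isOpen_univ
    (f := fun h x => ⟪p (w x), w (x + h • v)⟫_ℝ) hc0.continuousOn hc1.continuousOn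
    (fun h _ x => hd1 h x) (Set.mem_univ h)
  have hG' := hasDerivAt_setIntegral_of_continuousOn (isCompact_cell d) isOpen_univ
    (f := fun h x => ⟪p (w x), fderiv ℝ w (x + h • v) v⟫_ℝ) hc1.continuousOn hc2.continuousOn
    (fun h _ x => hd2 h x) (Set.mem_univ 0)
  have hint : ∀ g : Space d → ℝ, Continuous g → IntegrableOn g (cell d) := fun g hg =>
    hg.continuousOn.integrableOn_compact (isCompact_cell d)
  -- `G h = ∫ ⟪p (w x), w (x + h v)⟫` is maximal at `h = 0`: its increment is at most `∫ Φ (w (x + h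
  -- v)) - ∫ Φ (w x)`, which is `0` by translation invariance. Thus `p` is never differentiated.
  have key := second_deriv_nonpos_of_isMax hG hG' fun h => by
    have hΦper : IsTorusFun (Φ ∘ w) := fun i x => congrArg Φ (hper i x)
    have htrans := hΦper.setIntegral_cell_add (h • v)
    have h1 : Continuous fun x => ⟪p (w x), w (x + h • v)⟫_ℝ := by fun_prop
    have h2 : Continuous fun x => ⟪p (w x), w (x + (0 : ℝ) • v)⟫_ℝ := by fun_prop
    have h3 : Continuous fun x => (Φ ∘ w) (x + h • v) := by fun_prop
    have h4 : Continuous (Φ ∘ w) := by fun_prop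
    have h5 : ∫ x in cell d, (⟪p (w x), w (x + h • v)⟫_ℝ - ⟪p (w x), w (x + (0 : ℝ) • v)⟫_ℝ)
        ≤ ∫ x in cell d, ((Φ ∘ w) (x + h • v) - (Φ ∘ w) x) := by
      refine integral_mono (hint _ (h1.sub h2)) (hint _ (h3.sub h4)) fun x => ?_
      have := hsub (w x) (w (x + h • v))
      rw [inner_sub_right] at this
      simp only [zero_smul, add_zero, Function.comp_apply]
      linarith
    rw [integral_sub (hint _ h1) (hint _ h2), integral_sub (hint _ h3) (hint _ h4)] at h5
    linarith
  simpa using key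

theorem setIntegral_inner_laplacian_nonpos {d : ℕ} {w : Space d → E}
    (hw : ContDiff ℝ 2 w) (hper : IsTorusFun w) {Φ : E → ℝ} {p : E → E} (hp : Continuous p)
    (hsub : ∀ A B, Φ A + ⟪p A, B - A⟫_ℝ ≤ Φ B) :
    ∫ x in cell d, ⟪p (w x), Laplacian.laplacian w x⟫_ℝ ≤ 0 := by
  have hw1 : ContDiff ℝ 1 (fderiv ℝ w) := hw.fderiv_right (by norm_num)
  have hwc := hw.continuous
  have hw2c : Continuous (fderiv ℝ (fderiv ℝ w)) := hw1.continuous_fderiv (by norm_num)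
  set b := EuclideanSpace.basisFun (Fin d) ℝ
  have hL : ∀ x, ⟪p (w x), Laplacian.laplacian w x⟫_ℝ
      = ∑ i, ⟪p (w x), fderiv ℝ (fderiv ℝ w) x (b i) (b i)⟫_ℝ := fun x => by
    rw [InnerProductSpace.laplacian_eq_iteratedFDeriv_orthonormalBasis w b]
    simp [iteratedFDeriv_two_apply, inner_sum]
  simp_rw [hL]
  rw [integral_finsetSum _ fun i _ => (by fun_prop : Continuous _).continuousOn.integrableOn_compact
    (isCompact_cell d)]
  exact Finset.sum_nonpos fun i _ => setIntegral_inner_fderiv_fderiv_nonpos hw hper hp hsub _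

/-- The gradient of `ballPenalty`. -/
def ballPenaltyGrad (a : ℝ) (A : E) : E :=
  (max (‖A‖ - a) 0 / (√(1 + max (‖A‖ - a) 0 ^ 2) * max ‖A‖ a)) • A

/-- The denominator contains `max ‖A‖ a`, which equals `‖A‖` wherever the numerator is nonzero and
stays positive at the origin. -/
theorem continuous_ballPenaltyGrad {a : ℝ} (ha : 0 < a) :
    Continuous (ballPenaltyGrad a : E → E) := by
  unfold ballPenaltyGrad
  refine Continuous.smul (Continuous.div (by fun_prop) (by fun_prop) fun A => ?_) continuous_id
  have : 0 < max ‖A‖ a := lt_max_of_lt_right ha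
  positivity

theorem ballPenalty_subgradient {a : ℝ} (ha : 0 < a) (A B : E) :
    ballPenalty a A + ⟪ballPenaltyGrad a A, B - A⟫_ℝ ≤ ballPenalty a B := by
  unfold ballPenalty ballPenaltyGrad
  set s := max (‖A‖ - a) 0 with hs
  set s' := max (‖B‖ - a) 0 with hs'
  have hs0 : 0 ≤ s := le_max_right _ _
  have hs0' : 0 ≤ s' := le_max_right _ _
  have hq : 0 < √(1 + s ^ 2) := by positivity
  have hq2 : √(1 + s ^ 2) ^ 2 = 1 + s ^ 2 := Real.sq_sqrt (by positivity)
  have hM : 0 < max ‖A‖ a := lt_max_of_lt_right ha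
  -- Cauchy-Schwarz for `(1, s)` and `(1, s')`: this is the convexity of `√(1 + s²)`. The radial
  -- part, that of the distance to the ball, is `hmain`.
  have hCS : 1 + s * s' ≤ √(1 + s ^ 2) * √(1 + s' ^ 2) := by
    rw [← Real.sqrt_mul (by positivity)]
    exact Real.le_sqrt_of_sq_le (by nlinarith [sq_nonneg (s - s')])
  have hin : ⟪A, B - A⟫_ℝ ≤ ‖A‖ * (‖B‖ - ‖A‖) := by
    rw [inner_sub_right, real_inner_self_eq_norm_sq]
    linarith [real_inner_le_norm A B, sq ‖A‖, mul_sub ‖A‖ ‖B‖ ‖A‖]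
  have hmain : s / max ‖A‖ a * ⟪A, B - A⟫_ℝ ≤ s * (s' - s) := by
    rcases le_or_gt ‖A‖ a with h | h
    · have : s = 0 := max_eq_right (by linarith)
      simp [this]
    · have hsA : s = ‖A‖ - a := max_eq_left (by linarith)
      rw [max_eq_left h.le]
      have hA : 0 < ‖A‖ := ha.trans h
      calc s / ‖A‖ * ⟪A, B - A⟫_ℝ ≤ s / ‖A‖ * (‖A‖ * (‖B‖ - ‖A‖)) := by gcongr
        _ = s * (‖B‖ - ‖A‖) := by field_simp
        _ ≤ s * (s' - s) := by
          refine mul_le_mul_of_nonneg_left ?_ hs0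
          linarith [le_max_left (‖B‖ - a) 0]
  rw [real_inner_smul_left]
  have h1 : s / (√(1 + s ^ 2) * max ‖A‖ a) * ⟪A, B - A⟫_ℝ
      = (s / max ‖A‖ a * ⟪A, B - A⟫_ℝ) / √(1 + s ^ 2) := by
    field_simp
  rw [h1]
  have h2 : (s / max ‖A‖ a * ⟪A, B - A⟫_ℝ) / √(1 + s ^ 2) ≤ √(1 + s' ^ 2) - √(1 + s ^ 2) := by
    rw [div_le_iff₀ hq]
    nlinarith
  linarith

theorem inner_ballPenaltyGrad_nonpos {a : ℝ} (ha : 0 < a) {A V : E}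
    (h : a ≤ ‖A‖ → ⟪A, V⟫_ℝ ≤ 0) : ⟪ballPenaltyGrad a A, V⟫_ℝ ≤ 0 := by
  unfold ballPenaltyGrad
  rw [real_inner_smul_left]
  rcases le_or_gt a ‖A‖ with h1 | h1
  · have : 0 < max ‖A‖ a := lt_max_of_lt_right ha
    exact mul_nonpos_of_nonneg_of_nonpos (by positivity) (h h1)
  · rw [max_eq_right (by linarith : ‖A‖ - a ≤ 0)]
    simp

/-! ### Invariant balls for reaction-diffusion systems -/

/-- Invariance of the ball of radius `a` under a periodic reaction-diffusion system whose reaction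
term points inward outside of the ball. -/
theorem norm_le_of_reaction_diffusion {d : ℕ} {a κ : ℝ} (ha : 0 < a) (hκ : 0 ≤ κ)
    {u ut : ℝ → Space d → E} {u₀ : Space d → E}
    (hper : ∀ t > 0, IsTorusFun (u t))
    (hu : ContinuousOn (fun q : ℝ × Space d => u q.1 q.2) (Set.Ioi 0 ×ˢ Set.univ))
    (hut : ContinuousOn (fun q : ℝ × Space d => ut q.1 q.2) (Set.Ioi 0 ×ˢ Set.univ))
    (hC2 : ∀ t > 0, ContDiff ℝ 2 (u t))
    (hderiv : ∀ t > 0, ∀ x, HasDerivAt (fun s => u s x) (ut t x) t)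
    (hreact : ∀ t > 0, ∀ x, a ≤ ‖u t x‖ →
      ⟪u t x, ut t x - κ • Laplacian.laplacian (u t) x⟫_ℝ ≤ 0)
    (h₀ : ∀ x, ‖u₀ x‖ ≤ a)
    (hinit : Tendsto (fun t => ∫⁻ x in cell d, ‖u t x - u₀ x‖ₑ) (𝓝[>] 0) (𝓝 0))
    {t : ℝ} (ht : 0 < t) (x : Space d) : ‖u t x‖ ≤ a := by
  set Φ : E → ℝ := ballPenalty a
  set p : E → E := ballPenaltyGrad a
  have hp : Continuous p := continuous_ballPenaltyGrad ha
  have hsub := ballPenalty_subgradient (E := E) ha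
  have hΦd := hasFDerivAt_of_subgradient hp hsub
  have hΦ : Continuous Φ := continuous_iff_continuousAt.2 fun A => (hΦd A).continuousAt
  have hint : ∀ g : Space d → ℝ, Continuous g → IntegrableOn g (cell d) := fun g hg =>
    hg.continuousOn.integrableOn_compact (isCompact_cell d)
  set F : ℝ → ℝ := fun s => ∫ x in cell d, Φ (u s x) with hF
  have hFd : ∀ s > 0, HasDerivAt F (∫ x in cell d, ⟪p (u s x), ut s x⟫_ℝ) s := fun s hs =>
    hasDerivAt_setIntegral_of_continuousOn (isCompact_cell d) isOpen_Ioi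
      (f := fun s x => Φ (u s x)) (f' := fun s x => ⟪p (u s x), ut s x⟫_ℝ) (hΦ.comp_continuousOn hu) ((hp.comp_continuousOn hu).inner hut)
      (fun r hr y => by
        have := (hΦd (u r y)).comp_hasDerivAt r (hderiv r hr y)
        rwa [innerSL_apply_apply] at this) hs
  have hF' : ∀ s > 0, ∫ x in cell d, ⟪p (u s x), ut s x⟫_ℝ ≤ 0 := fun s hs => by
    have hutc : Continuous (ut s) := continuousOn_univ.1 (hut.comp
      (by fun_prop : Continuous fun x : Space d => (s, x)).continuousOn fun x _ => ⟨hs, trivial⟩)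
    have hLc : Continuous (Laplacian.laplacian (u s)) := by
      rw [InnerProductSpace.laplacian_eq_iteratedFDeriv_orthonormalBasis (u s)
        (EuclideanSpace.basisFun (Fin d) ℝ)]
      have := (hC2 s hs).continuous_iteratedFDeriv (m := 2) le_rfl
      fun_prop
    have huc := (hC2 s hs).continuous
    have hlap := setIntegral_inner_laplacian_nonpos (hC2 s hs) (hper s hs) hp hsub
    calc ∫ x in cell d, ⟪p (u s x), ut s x⟫_ℝ
        ≤ ∫ x in cell d, κ * ⟪p (u s x), Laplacian.laplacian (u s) x⟫_ℝ := by
          refine integral_mono (hint _ (by fun_prop)) (hint _ (by fun_prop)) fun y => ?_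
          have := inner_ballPenaltyGrad_nonpos ha (hreact s hs y)
          rw [inner_sub_right, real_inner_smul_right] at this
          exact sub_nonpos.1 this
      _ ≤ 0 := by
          rw [integral_const_mul]
          exact mul_nonpos_of_nonneg_of_nonpos hκ hlap
  have hanti : AntitoneOn F (Set.Ioi 0) := by
    refine antitoneOn_of_deriv_nonpos (convex_Ioi 0)
      (fun s hs => (hFd s hs).continuousAt.continuousWithinAt) ?_ ?_ <;> rw [interior_Ioi]
    · exact fun s hs => (hFd s hs).differentiableAt.differentiableWithinAt
    · exact fun s hs => by rw [(hFd s hs).deriv]; exact hF' s hs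
  -- Since `‖u₀‖ ≤ a`, the excess `‖u‖ - a` is at most `‖u - u₀‖`.
  have hFle : ∀ s > 0, ENNReal.ofReal (F s) ≤ ∫⁻ x in cell d, ‖u s x - u₀ x‖ₑ := fun s hs => by
    have huc := (hC2 s hs).continuous
    have hΦu : Continuous fun y => Φ (u s y) := hΦ.comp huc
    simp only [hF]
    rw [ofReal_integral_eq_lintegral_ofReal (hint _ hΦu)
      (Eventually.of_forall fun y => ballPenalty_nonneg a _)]
    refine lintegral_mono fun y => ?_
    rw [← ofReal_norm]
    refine ENNReal.ofReal_le_ofReal ((ballPenalty_le a _).trans (max_le ?_ (norm_nonneg _)))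
    linarith [norm_sub_norm_le (u s y) (u₀ y), h₀ y]
  -- By monotonicity `F t ≤ F s ≤ ‖u s - u₀‖_{L¹}` for `0 < s < t`; let `s ↓ 0`.
  have hFt : F t ≤ 0 := by
    rw [← ENNReal.ofReal_eq_zero, ← nonpos_iff_eq_zero]
    refine ge_of_tendsto hinit ?_
    filter_upwards [Ioo_mem_nhdsGT ht] with s hs
    exact (ENNReal.ofReal_le_ofReal (hanti hs.1 ht hs.2.le)).trans (hFle s hs.1)
  have huc := (hC2 t ht).continuous
  have hΦu : Continuous fun y => Φ (u t y) := by fun_prop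
  have hae : (fun y => Φ (u t y)) =ᵐ[volume.restrict (cell d)] 0 :=
    (integral_eq_zero_iff_of_nonneg (fun y => ballPenalty_nonneg a _) (hint _ hΦu)).1
      (le_antisymm hFt (integral_nonneg fun y => ballPenalty_nonneg a _))
  have hcell := Measure.eqOn_of_ae_eq hae hΦu.continuousOn continuousOn_const
    (cell_subset_closure_interior d)
  obtain ⟨g, hg⟩ := exists_add_period_mem_cell x
  rw [← (hper t ht).add_period g x]
  exact norm_le_of_ballPenalty_eq_zero (hcell hg)

end

/-! ### The matrix-valued Allen-Cahn equation -/

/-- A matrix as a vector of its entries; its Euclidean norm is the Frobenius norm. -/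
def matVec {m : ℕ} (A : Mat m) : EuclideanSpace ℝ (Fin m × Fin m) :=
  WithLp.toLp 2 fun q => A q.1 q.2

@[simp] theorem matVec_apply {m : ℕ} (A : Mat m) (q : Fin m × Fin m) :
    matVec A q = A q.1 q.2 := rfl

theorem inner_matVec {m : ℕ} (A B : Mat m) :
    ⟪matVec A, matVec B⟫_ℝ = (A * B.transpose).trace := by
  simp [PiLp.inner_apply, Fintype.sum_prod_type, Matrix.trace, Matrix.mul_apply, mul_comm]

theorem norm_matVec_sq {m : ℕ} (A : Mat m) : ‖matVec A‖ ^ 2 = (A * A.transpose).trace := by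
  rw [← real_inner_self_eq_norm_sq, inner_matVec]

theorem norm_matVec_le_sqrt_iff {m : ℕ} (A : Mat m) {c : ℝ} (hc : 0 ≤ c) :
    ‖matVec A‖ ≤ √c ↔ (A * A.transpose).trace ≤ c := by
  rw [← norm_matVec_sq, Real.le_sqrt (norm_nonneg _) hc]

/-- The reaction term points inward outside of the ball of radius `√m`. -/
theorem inner_reaction_nonpos {m : ℕ} {A : Mat m} (h : √(m : ℝ) ≤ ‖matVec A‖) :
    ⟪matVec A, matVec (A - A * A.transpose * A)⟫_ℝ ≤ 0 := by
  rw [Real.sqrt_le_left (norm_nonneg _), norm_matVec_sq] at h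
  -- With `S = A Aᵀ`, `tr (S - 1)² ≥ 0` gives `tr S² ≥ 2 tr S - m`, which is at least `tr S` once
  -- `tr S ≥ m`. The inner product is `tr S - tr S²`.
  have h1 := (posSemidef_mul_transpose_self (A * A.transpose - 1)).trace_nonneg
  have h2 : (A * A.transpose - 1) * (A * A.transpose - 1).transpose
      = A * (A * A.transpose * A).transpose - (2 : ℝ) • (A * A.transpose) + 1 := by
    simp only [Matrix.transpose_sub, Matrix.transpose_mul, Matrix.transpose_transpose,
      Matrix.transpose_one, sub_mul, mul_sub, mul_one, one_mul, Matrix.mul_assoc, two_smul]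
    abel
  rw [h2, Matrix.trace_add, Matrix.trace_sub, Matrix.trace_smul, Matrix.trace_one,
    Fintype.card_fin, smul_eq_mul] at h1
  rw [inner_matVec, Matrix.transpose_sub, mul_sub, Matrix.trace_sub]
  linarith

/-- Solutions of the matrix-valued Allen-Cahn equation stay in the Frobenius ball of
radius `√m`. -/
theorem IsMACSolution.trace_le {d m : ℕ} {ε : ℝ} {U₀ : Space d → Mat m}
    {U : ℝ → Space d → Mat m} (hU : IsMACSolution ε U₀ U) (hm : 0 < m)
    (hmeas : ∀ i j, AEMeasurable (fun x => U₀ x i j) volume)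
    (h₀ : ∀ x, (U₀ x * (U₀ x).transpose).trace ≤ m) {t : ℝ} (ht : 0 < t) (x : Space d) :
    (U t x * (U t x).transpose).trace ≤ m := by
  rw [← norm_matVec_le_sqrt_iff _ m.cast_nonneg]
  have hC2 : ∀ s > 0, ContDiff ℝ 2 fun y => matVec (U s y) := fun s hs =>
    contDiff_euclidean.2 fun q => hU.contDiff_space s hs q.1 q.2
  have hlap : ∀ s > 0, ∀ y q, Laplacian.laplacian (fun y => matVec (U s y)) y q
      = Laplacian.laplacian (fun y => U s y q.1 q.2) y := fun s hs y q =>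
    ((hC2 s hs).contDiffAt.laplacian_CLM_comp_left
      (l := (EuclideanSpace.proj q : EuclideanSpace ℝ (Fin m × Fin m) →L[ℝ] ℝ))).symm
  refine norm_le_of_reaction_diffusion (a := √(m : ℝ)) (κ := ε ^ 2)
    (u := fun s y => matVec (U s y))
    (ut := fun s y => matVec (Matrix.of fun i j => deriv (fun s => U s y i j) s))
    (u₀ := fun y => matVec (U₀ y)) (by positivity) (sq_nonneg ε)
    (fun s hs i y => congrArg matVec (hU.periodic s hs i y)) ?_ ?_ hC2 ?_ ?_
    (fun y => (norm_matVec_le_sqrt_iff _ m.cast_nonneg).2 (h₀ y)) ?_ ht x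
  · refine (PiLp.continuous_toLp 2 _).comp_continuousOn (continuousOn_pi.2 fun q => ?_)
    exact continuousOn_pi.1 (continuousOn_pi.1 hU.continuousOn q.1) q.2
  · exact (PiLp.continuous_toLp 2 _).comp_continuousOn
      (continuousOn_pi.2 fun q => hU.continuousOn_deriv q.1 q.2)
  · intro s hs y
    exact (EuclideanSpace.equiv (Fin m × Fin m) ℝ).symm.hasFDerivAt.comp_hasDerivAt s
      (hasDerivAt_pi.2 fun q => (hU.equation s hs y q.1 q.2).differentiableAt.hasDerivAt)
  · intro s hs y h
    convert inner_reaction_nonpos h using 2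
    ext q
    have := (hU.equation s hs y q.1 q.2).deriv
    simp only [PiLp.sub_apply, PiLp.smul_apply, matVec_apply, Matrix.of_apply, smul_eq_mul, this]
    rw [hlap s hs y q]
    ring
  · have hsum : Tendsto (fun s => ∑ q : Fin m × Fin m,
        eLpNorm (fun y => U s y q.1 q.2 - U₀ y q.1 q.2) 1 (volume.restrict (cell d)))
        (𝓝[>] 0) (𝓝 0) := by
      simpa using tendsto_finsetSum Finset.univ fun (q : Fin m × Fin m) _ => hU.tendsto_initial q.1 q.2
    refine tendsto_of_tendsto_of_tendsto_of_le_of_le' tendsto_const_nhds hsum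
      (Eventually.of_forall fun _ => zero_le) ?_
    filter_upwards [self_mem_nhdsWithin] with s hs
    simp_rw [eLpNorm_one_eq_lintegral_enorm]
    rw [← lintegral_finsetSum' _ fun q _ =>
      (((hU.contDiff_space s hs q.1 q.2).continuous.aemeasurable.sub
        (hmeas q.1 q.2)).restrict).enorm]
    refine lintegral_mono fun y => ?_
    -- Splitting into single entries bounds the Euclidean norm by the sum of the absolute values,
    -- matching the entrywise `L¹` convergence.
    have hv : matVec (U s y) - matVec (U₀ y)
        = ∑ q, EuclideanSpace.single q (U s y q.1 q.2 - U₀ y q.1 q.2) := by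
      ext q
      simp [Finset.sum_apply, Pi.single_apply]
    rw [hv]
    refine (enorm_sum_le _ _).trans (Finset.sum_le_sum fun q _ => ?_)
    rw [← ofReal_norm, ← ofReal_norm, PiLp.norm_single]

end

theorem theorem3p5 (d m : ℕ) (ε : ℝ) (hε : 0 < ε) (U₀ : Space d → Mat m)
    (hmeas : ∀ i j, AEMeasurable (fun x => U₀ x i j) volume)
    (hper : IsTorusFun U₀)
    (hbound : ∀ x, frobNorm (U₀ x) ≤ √(m : ℝ)) :
    (∀ U : ℝ → Space d → Mat m, IsMACSolution ε U₀ U →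
      ∀ t : ℝ, 0 ≤ t → ∀ x, |(U t x).det| ≤ 1) ∧
    (∀ τ : ℝ, 0 < τ → ∀ (n : ℕ) (x : Space d), |(strang ε τ U₀ n x).det| ≤ 1) := by
  have h₀ : ∀ x, (U₀ x * (U₀ x).transpose).trace ≤ m := fun x =>
    (frobNorm_le_sqrt_iff _ m.cast_nonneg).1 (hbound x)
  refine ⟨fun U hU t ht x => ?_, fun τ hτ n x =>
    abs_det_le_one_of_trace_le ((strang_invariant hε hτ hmeas h₀ n).2 x)⟩
  -- For `m = 0` the radius `√m` is not positive, but the empty determinant is `1`.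
  rcases m.eq_zero_or_pos with rfl | hm
  · simp
  rcases ht.eq_or_lt with rfl | ht
  · rw [hU.initial]
    exact abs_det_le_one_of_trace_le (h₀ x)
  · exact abs_det_le_one_of_trace_le (hU.trace_le hm hmeas h₀ ht x)
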